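/- Let $\varphi_0,\varphi_1,\dots$ be an acceptable numbering of the partial recursive functions, $W_e$ the domain of $\varphi_e$, and let $\eta$ be an r.e. (positive) equivalence relation on $\mathbb N$ with infinitely many equivalence classes. A set is $\eta$-infinite if it is a union of infinitely many $\eta$-classes. An $\eta$-family is a class $\mathcal C=\{B_0,B_1,\dots\}$ of unions of $\eta$-classes, where $(B_k)_{k\in\mathbb N}$ is uniformly r.e. and the $B_k$ are pairwise distinct. A text $T$ is a map $\mathbb N\to\mathbb N\cup\{\#\}$; $T[n]$ is its initial segment of length $n$, $\mathrm{cnt}(\cdot)$ denotes the set of numbers occurring in a text or finite sequence, and $T$ is a text for $L$ if $\mathrm{cnt}(T)=L$. A learner is a recursive function $M:(\mathbb N\cup\{\#\})^*\to\mathbb N\cup\{?\}$; a value $e\in\mathbb N$ is a hypothesis and stands for the set $H_e$ of a hypothesis space $(H_e)_{e\in\mathbb N}$, by default $H_e=$ the $\eta$-closure of $W_e$ (the union of the $\eta$-classes of its elements). Then - $M$ Ex-learns $\mathcal C$ if for every $L\in\mathcal C$ and every text $T$ for $L$ there are $n$ and $e$ with $H_e=L$ and $M(T[j])=e$ for all $j\ge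 n$; - $M$ BC-learns $\mathcal C$ if for every $L\in\mathcal C$ and every text $T$ for $L$ there is $n$ such that for all $j\ge n$, $M(T[j])$ is a hypothesis $e$ with $H_e=L$; - $M$ is monotonic on $\mathcal C$ if for every text $T$ for a member of $\mathcal C$ and all $n,k$ such that $M(T[n])=i$ and $M(T[n+k])=j$ are hypotheses, $H_i\cap\mathrm{cnt}(T)\subseteq H_j\cap\mathrm{cnt}(T)$; - $M$ is weakly monotonic if for every text $T$ whatsoever and all $n,k$ such that $M(T[n])=i$ and $M(T[n+k])=j$ are hypotheses, $\mathrm{cnt}(T[n+k])\subseteq H_i$ implies $H_i\subseteq H_j$. $\mathcal C$ is Ex-learnable if some learner Ex-learns it, and monotonically BC-learnable if some learner BC-learns it and is monotonic on it, both with the default hypothesis space. $\mathcal C$ is class-preservingly weakly monotonically Ex-learnable if there are a uniformly r.e. hypothesis space $(H_e)_{e\in\mathbb N}$ with $\{H_e:e\in\mathbb N\}=\mathcal C$ and a weakly monotonic learner that Ex-learns $\mathcal C$, both with respect to $(H_e)_{e\in\mathbb N}$. **Theorem.** The following are equivalent: 1. there is an $\eta$-family that is Ex-learnable but not monotonically BC-learnable;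 2. there is an $\eta$-family that is class-preservingly weakly monotonically Ex-learnable but not monotonically BC-learnable; 3. there is an $\eta$-infinite r.e. set different from $\mathbb N$. -/

import Mathlib

namespace EtaLearning

/-- An acceptable (Goedel) numbering of the unary partial recursive functions: `φ` is a partial
recursive function of two arguments, every unary partial recursive function is some `φ e`, and every
partial recursive numbering `ψ` reduces to `φ` by a recursive function. -/
structure IsAcceptable (φ : ℕ → ℕ →. ℕ) : Prop where
  partrec : Partrec₂ φ
  surj : ∀ f : ℕ →. ℕ, Partrec f → ∃ e, φ e = f
  reduces : ∀ ψ : ℕ → ℕ →. ℕ, Partrec₂ ψ → ∃ c : ℕ → ℕ, Computable c ∧ ∀ e, ψ e = φ (c e)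

/-- The r.e. set `W e`, the domain of `φ e`. -/
def W (φ : ℕ → ℕ →. ℕ) (e : ℕ) : Set ℕ := {x | (φ e x).Dom}

/-- A positive equivalence relation: a recursively enumerable one. -/
def IsPositive (η : Setoid ℕ) : Prop := REPred fun p : ℕ × ℕ => η p.1 p.2

/-- A union of `η`-classes. -/
def IsEtaClosed (η : Setoid ℕ) (A : Set ℕ) : Prop := ∀ x y : ℕ, η x y → x ∈ A → y ∈ A

/-- The `η`-closure of `A`, i.e. the union of the `η`-classes of the elements of `A`. -/
def etaClosure (η : Setoid ℕ) (A : Set ℕ) : Set ℕ := {y | ∃ x ∈ A, η x y}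

/-- A union of infinitely many `η`-classes. -/
def IsEtaInfinite (η : Setoid ℕ) (A : Set ℕ) : Prop :=
  IsEtaClosed η A ∧ ((Quotient.mk η) '' A).Infinite

/-- A uniformly r.e. sequence of sets. -/
def UniformlyRE (B : ℕ → Set ℕ) : Prop := REPred fun p : ℕ × ℕ => p.2 ∈ B p.1

/-- An `η`-family: an (infinite) class with a uniformly r.e. one-one numbering, each of whose
members is a union of `η`-classes. -/
def IsEtaFamily (η : Setoid ℕ) (C : Set (Set ℕ)) : Prop :=
  (∃ B : ℕ → Set ℕ, UniformlyRE B ∧ Function.Injective B ∧ Set.range B = C) ∧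
    ∀ L ∈ C, IsEtaClosed η L

/-- A text; `none` is the pause symbol. -/
abbrev Text := ℕ → Option ℕ

/-- The set of numbers that occur in a text. -/
def Text.content (T : Text) : Set ℕ := {x | ∃ i, T i = some x}

/-- The initial segment `T 0, ..., T (n - 1)`. -/
def Text.init (T : Text) (n : ℕ) : List (Option ℕ) := (List.range n).map T

/-- The set of numbers that occur in a finite sequence. -/
def seqContent (σ : List (Option ℕ)) : Set ℕ := {x | some x ∈ σ}

/-- `M` maps finite sequences of numbers and pauses to hypotheses; the value `none` is the symbol
`?` by which a learner abstains. Learners are moreover required to be `Computable`. -/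
abbrev Learner := List (Option ℕ) → Option ℕ

/-- `M` explanatorily learns `C` with hypothesis space `H`. -/
def ExLearns (H : ℕ → Set ℕ) (M : Learner) (C : Set (Set ℕ)) : Prop :=
  ∀ L ∈ C, ∀ T : Text, T.content = L →
    ∃ n e, H e = L ∧ ∀ j, n ≤ j → M (T.init j) = some e

/-- `M` behaviourally correctly learns `C` with hypothesis space `H`. -/
def BCLearns (H : ℕ → Set ℕ) (M : Learner) (C : Set (Set ℕ)) : Prop :=
  ∀ L ∈ C, ∀ T : Text, T.content = L →
    ∃ n, ∀ j, n ≤ j → ∃ e, M (T.init j) = some e ∧ H e = L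

/-- Monotonicity of `M` with respect to the target class `C` and hypothesis space `H`. -/
def IsMonotonic (H : ℕ → Set ℕ) (M : Learner) (C : Set (Set ℕ)) : Prop :=
  ∀ T : Text, T.content ∈ C → ∀ n k i j : ℕ,
    M (T.init n) = some i → M (T.init (n + k)) = some j →
      H i ∩ T.content ⊆ H j ∩ T.content

/-- Weak monotonicity of `M` with respect to the hypothesis space `H`, on all texts. -/
def IsWeaklyMonotonic (H : ℕ → Set ℕ) (M : Learner) : Prop :=
  ∀ (T : Text) (n k i j : ℕ),
    M (T.init n) = some i → M (T.init (n + k)) = some j →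
      seqContent (T.init (n + k)) ⊆ H i → H i ⊆ H j

/-- The default hypothesis space: the `η`-closures of the sets `W e`. -/
def defaultSpace (φ : ℕ → ℕ →. ℕ) (η : Setoid ℕ) (e : ℕ) : Set ℕ := etaClosure η (W φ e)

/-- Explanatory learnability (default hypothesis space). -/
def ExLearnable (φ : ℕ → ℕ →. ℕ) (η : Setoid ℕ) (C : Set (Set ℕ)) : Prop :=
  ∃ M : Learner, Computable M ∧ ExLearns (defaultSpace φ η) M C

/-- Monotonic behaviourally correct learnability (default hypothesis space). -/
def MonotonicBCLearnable (φ : ℕ → ℕ →. ℕ) (η : Setoid ℕ) (C : Set (Set ℕ)) : Prop :=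
  ∃ M : Learner, Computable M ∧ BCLearns (defaultSpace φ η) M C ∧
    IsMonotonic (defaultSpace φ η) M C

/-- Class-preserving weakly monotonic explanatory learnability: the hypothesis space is some
uniformly r.e. numbering whose members are exactly those of the target class. -/
def ClassPreservingWeaklyMonotonicExLearnable (C : Set (Set ℕ)) : Prop :=
  ∃ H : ℕ → Set ℕ, UniformlyRE H ∧ Set.range H = C ∧
    ∃ M : Learner, Computable M ∧ ExLearns H M C ∧ IsWeaklyMonotonic H M

end EtaLearning

/-! Suppose `ℕ` is the only r.e. `η`-infinite set. Then every member of an `η`-family is `ℕ` or a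
finite union of classes. A finite union of classes is found in the limit as the closure of the data.
If `ℕ` belongs to an Ex-learnable family, it has a finite telltale contained in no other member
(`ExLearns.exists_telltale_univ`), and the learner switches to `ℕ` once the telltale has appeared.
All these hypotheses grow along a text, so this learner is monotonic
(`monotonicBCLearnable_of_finite`).

Conversely, let `A = {a 0, a 1, ...}` be r.e. and `η`-infinite, with `b ∉ A`. The family consists of
`A` and of the finite unions `[b] ∪ [a 0] ∪ ... ∪ [a (j - 1)]`. The mark `b` tells the two kinds
apart: conjecture `A` until an equivalent of `b` is found, then the longest initial part of `a`
recognized in the data. This learner is weakly monotonic, since the change of mind away from `A` is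
forced by data outside `A`. A monotonic BC-learner is defeated by leading it to `A`, then to a
marked finite part of `A`, and then revealing an element of `A` given up on the way
(`not_isMonotonic_of_bcLearns_markedClass`).

The remaining implication translates a class-preserving hypothesis space into the acceptable
numbering. -/

section RecursivelyEnumerable

/-! ### Closure properties of r.e. predicates. -/

variable {α β : Type*} [Primcodable α] [Primcodable β]

/-- An r.e. predicate is the union of an increasing sequence of uniformly primitive recursive
predicates. -/
theorem REPred.exists_primrecRel {p : α → Prop} (h : REPred p) :
    ∃ R : α → ℕ → Prop, PrimrecRel R ∧ (∀ a s t, s ≤ t → R a s → R a t) ∧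
      ∀ a, p a ↔ ∃ s, R a s := by
  obtain ⟨c, hc⟩ := Nat.Partrec.Code.exists_code.1 h
  refine ⟨fun a s => (Nat.Partrec.Code.evaln s c (Encodable.encode a)).isSome = true, ?_, ?_, ?_⟩
  · have hp : Primrec₂ fun (a : α) (s : ℕ) =>
        (Nat.Partrec.Code.evaln s c (Encodable.encode a)).isSome :=
      Primrec.option_isSome.comp (Nat.Partrec.Code.primrec_evaln.comp
        (((Primrec.snd).pair (Primrec.const c)).pair (Primrec.encode.comp Primrec.fst)))
    exact Primrec₂.primrecRel (hp.of_eq fun a s => by simp)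
  · intro a s t hst hs
    obtain ⟨x, hx⟩ := Option.isSome_iff_exists.1 hs
    exact Option.isSome_iff_exists.2 ⟨x, Nat.Partrec.Code.evaln_mono hst hx⟩
  · intro a
    have hdom : p a ↔ (Nat.Partrec.Code.eval c (Encodable.encode a)).Dom := by
      rw [hc]
      simp [Part.assert]
    rw [hdom, Part.dom_iff_mem]
    constructor
    · rintro ⟨x, hx⟩
      obtain ⟨s, hs⟩ := Nat.Partrec.Code.evaln_complete.1 hx
      exact ⟨s, Option.isSome_iff_exists.2 ⟨x, hs⟩⟩
    · rintro ⟨s, hs⟩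
      obtain ⟨x, hx⟩ := Option.isSome_iff_exists.1 hs
      exact ⟨x, Nat.Partrec.Code.evaln_sound hx⟩

theorem PrimrecRel.rePred_exists {R : α → ℕ → Prop} (h : PrimrecRel R) :
    REPred fun a => ∃ s, R a s := by
  classical
  have hp : Partrec fun a => Nat.rfind fun s => Part.some (decide (R a s)) :=
    Partrec.rfind (Computable.partrec h.decide.to_comp)
  refine (Partrec.dom_re hp).of_eq fun a => ?_
  refine Nat.rfind_dom.trans ?_
  simp

theorem PrimrecPred.rePred {p : α → Prop} (h : PrimrecPred p) : REPred p := by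
  classical
  exact ComputablePred.to_re ⟨inferInstance, h.decide.to_comp⟩

theorem REPred.comp {p : β → Prop} (h : REPred p) {f : α → β} (hf : Computable f) :
    REPred fun a => p (f a) :=
  Partrec.comp h hf

theorem REPred.and {p q : α → Prop} (hp : REPred p) (hq : REPred q) :
    REPred fun a => p a ∧ q a := by
  obtain ⟨R, hR, Rmono, hpR⟩ := hp.exists_primrecRel
  obtain ⟨S, hS, Smono, hqS⟩ := hq.exists_primrecRel
  have h : PrimrecRel fun a s => R a s ∧ S a s := PrimrecPred.and hR hS
  refine h.rePred_exists.of_eq fun a => ?_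
  rw [hpR, hqS]
  constructor
  · rintro ⟨s, h₁, h₂⟩
    exact ⟨⟨s, h₁⟩, ⟨s, h₂⟩⟩
  · rintro ⟨⟨s, h₁⟩, ⟨t, h₂⟩⟩
    exact ⟨max s t, Rmono _ _ _ (le_max_left _ _) h₁, Smono _ _ _ (le_max_right _ _) h₂⟩

theorem REPred.or {p q : α → Prop} (hp : REPred p) (hq : REPred q) :
    REPred fun a => p a ∨ q a := by
  obtain ⟨R, hR, -, hpR⟩ := hp.exists_primrecRel
  obtain ⟨S, hS, -, hqS⟩ := hq.exists_primrecRel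
  have h : PrimrecRel fun a s => R a s ∨ S a s := PrimrecPred.or hR hS
  refine h.rePred_exists.of_eq fun a => ?_
  rw [hpR, hqS, exists_or]

theorem REPred.exists {p : α × β → Prop} (hp : REPred p) : REPred fun a => ∃ b, p (a, b) := by
  obtain ⟨R, hR, -, hpR⟩ := hp.exists_primrecRel
  -- Dovetailing: `n` codes a candidate witness together with a number of steps.
  have h : PrimrecRel fun (a : α) (n : ℕ) =>
      ∃ b ∈ (Encodable.decode (α := β) n.unpair.1).toList, R (a, b) n.unpair.2 := by
    have hR' : PrimrecRel fun (b : β) (x : α × ℕ) => R (x.1, b) x.2 :=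
      PrimrecRel.comp hR
        ((Primrec.fst.comp Primrec.snd).pair Primrec.fst) (Primrec.snd.comp Primrec.snd)
    have hn : Primrec fun x : α × ℕ => x.2.unpair := Primrec.unpair.comp Primrec.snd
    exact hR'.exists_mem_list.comp
      (Primrec.optionToList.comp (Primrec.decode.comp (Primrec.fst.comp hn)))
      (Primrec.fst.pair (Primrec.snd.comp hn))
  refine h.rePred_exists.of_eq fun a => ?_
  simp only [hpR]
  constructor
  · rintro ⟨n, b, -, hb⟩
    exact ⟨b, _, hb⟩
  · rintro ⟨b, s, hs⟩
    exact ⟨Nat.pair (Encodable.encode b) s, b, by simpa using hs⟩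

/-- Finitely many searches succeed together at the maximum of their stages, because the
approximations increase. -/
theorem REPred.forall_lt {p : α × ℕ → Prop} (hp : REPred p) :
    REPred fun x : α × ℕ => ∀ i < x.2, p (x.1, i) := by
  obtain ⟨R, hR, Rmono, hpR⟩ := hp.exists_primrecRel
  have h : PrimrecRel fun (x : α × ℕ) (s : ℕ) => ∀ i < x.2, R (x.1, i) s := by
    have hR' : PrimrecRel fun (i : ℕ) (y : α × ℕ) => R (y.1, i) y.2 :=
      PrimrecRel.comp hR
        ((Primrec.fst.comp Primrec.snd).pair Primrec.fst) (Primrec.snd.comp Primrec.snd)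
    exact (hR'.forall_mem_list.comp
      (Primrec.list_range.comp (Primrec.snd.comp Primrec.fst))
      ((Primrec.fst.comp Primrec.fst).pair Primrec.snd)).of_eq fun x => by simp
  refine h.rePred_exists.of_eq fun x => ?_
  simp only [hpR]
  constructor
  · rintro ⟨s, hs⟩ i hi
    exact ⟨s, hs i hi⟩
  · intro h
    choose! f hf using h
    exact ⟨(Finset.range x.2).sup f, fun i hi =>
      Rmono _ _ _ (Finset.le_sup (f := f) (Finset.mem_range.2 hi)) (hf i hi)⟩

/-- A nonempty r.e. set of natural numbers is the range of a primitive recursive function. -/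
theorem REPred.exists_primrec_range {A : Set ℕ} (hA : REPred fun x => x ∈ A) (hne : A.Nonempty) :
    ∃ a : ℕ → ℕ, Primrec a ∧ Set.range a = A := by
  classical
  obtain ⟨R, hR, -, hAR⟩ := hA.exists_primrecRel
  obtain ⟨x₀, hx₀⟩ := hne
  -- A failed check outputs `x₀`, which already lies in `A`; this makes the enumeration total.
  refine ⟨fun n => if R n.unpair.1 n.unpair.2 then n.unpair.1 else x₀, ?_, ?_⟩
  · exact Primrec.ite (hR.comp (Primrec.fst.comp Primrec.unpair)
      (Primrec.snd.comp Primrec.unpair)) (Primrec.fst.comp Primrec.unpair) (Primrec.const x₀)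
  · ext x
    constructor
    · rintro ⟨n, rfl⟩
      dsimp only
      split_ifs with h
      · exact (hAR _).2 ⟨_, h⟩
      · exact hx₀
    · intro hx
      obtain ⟨s, hs⟩ := (hAR x).1 hx
      exact ⟨Nat.pair x s, by simp [hs]⟩

end RecursivelyEnumerable

namespace EtaLearning

/-! ### Texts -/

theorem seqContent_init (T : Text) (n : ℕ) :
    seqContent (T.init n) = {x | ∃ i < n, T i = some x} := by
  ext x
  simp [seqContent, Text.init]

theorem seqContent_init_subset (T : Text) (n : ℕ) : seqContent (T.init n) ⊆ T.content := by
  rw [seqContent_init]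
  rintro x ⟨i, -, hi⟩
  exact ⟨i, hi⟩

theorem seqContent_init_mono (T : Text) {m n : ℕ} (h : m ≤ n) :
    seqContent (T.init m) ⊆ seqContent (T.init n) := by
  simp only [seqContent_init]
  rintro x ⟨i, hi, hx⟩
  exact ⟨i, hi.trans_le h, hx⟩

theorem length_init (T : Text) (n : ℕ) : (T.init n).length = n := by simp [Text.init]

/-- Finitely many elements of the content of a text all occur in some initial segment. -/
theorem exists_subset_seqContent_init (T : Text) {D : Set ℕ} (hD : D.Finite)
    (h : D ⊆ T.content) : ∃ n, D ⊆ seqContent (T.init n) := by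
  have h' : ∀ x ∈ D, ∃ i, T i = some x := fun x hx => h hx
  choose! f hf using h'
  obtain ⟨N, hN⟩ := (hD.image f).bddAbove
  refine ⟨N + 1, fun x hx => ?_⟩
  rw [seqContent_init]
  exact ⟨f x, Nat.lt_succ_of_le (hN ⟨x, hx, rfl⟩), hf x hx⟩

/-- The text that lists the elements of `L` in increasing order, with pauses. -/
noncomputable def textOf (L : Set ℕ) : Text := by
  classical exact fun i => if i ∈ L then some i else none

theorem content_textOf (L : Set ℕ) : (textOf L).content = L := by
  ext x
  simp only [Text.content, textOf, Set.mem_ofPred_eq]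
  constructor
  · rintro ⟨i, hi⟩
    split_ifs at hi with h
    cases hi
    exact h
  · intro h
    exact ⟨x, by simp [h]⟩

/-- The text that starts with the finite sequence `σ` and continues with the text `T`. -/
def Text.prepend (σ : List (Option ℕ)) (T : Text) : Text := fun i =>
  if h : i < σ.length then σ[i] else T (i - σ.length)

theorem init_prepend (σ : List (Option ℕ)) (T : Text) (k : ℕ) :
    (T.prepend σ).init (σ.length + k) = σ ++ T.init k := by
  apply List.ext_getElem
  · simp [Text.init]
  · intro i h₁ h₂
    by_cases h : i < σ.length
    · simp [Text.init, Text.prepend, h]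
    · simp [Text.init, Text.prepend, h, List.getElem_append]

theorem init_prepend_of_le (T T' : Text) {m n : ℕ} (h : m ≤ n) :
    (T'.prepend (T.init n)).init m = T.init m := by
  apply List.ext_getElem
  · simp [Text.init]
  · intro i h₁ h₂
    have hi : i < n := by
      rw [length_init] at h₁
      omega
    simp [Text.init, Text.prepend, hi]

theorem content_prepend (σ : List (Option ℕ)) (T : Text) :
    (T.prepend σ).content = seqContent σ ∪ T.content := by
  ext x
  constructor
  · rintro ⟨i, hi⟩
    by_cases h : i < σ.length
    · left
      simp only [Text.prepend, h, dif_pos] at hi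
      have hmem := List.getElem_mem h
      rw [hi] at hmem
      exact hmem
    · right
      simp only [Text.prepend, h, dif_neg, not_false_eq_true] at hi
      exact ⟨_, hi⟩
  · rintro (h | ⟨i, hi⟩)
    · obtain ⟨i, hi, hx⟩ := List.getElem_of_mem h
      exact ⟨i, by simp [Text.prepend, hi, hx]⟩
    · exact ⟨σ.length + i, by simp [Text.prepend, hi]⟩

theorem content_prepend_textOf {σ : List (Option ℕ)} {L : Set ℕ} (h : seqContent σ ⊆ L) :
    ((textOf L).prepend σ).content = L := by
  rw [content_prepend, content_textOf, Set.union_eq_self_of_subset_left h]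

/-- An increasing chain of ever longer finite sequences has a limit text. -/
theorem exists_text_of_chain (g : ℕ → List (Option ℕ)) (hg : ∀ n, g n <+: g (n + 1))
    (hlen : ∀ n, n ≤ (g n).length) : ∃ T : Text, ∀ n, T.init (g n).length = g n := by
  have hmono : ∀ m n, m ≤ n → g m <+: g n := fun m n h => by
    induction n, h using Nat.le_induction with
    | base => exact List.prefix_refl _
    | succ n _ ih => exact ih.trans (hg n)
  -- `g (i + 1)` is long enough to have a position `i`, so the default `none` never occurs.
  refine ⟨fun i => (g (i + 1)).getD i none, fun n => ?_⟩
  apply List.ext_getElem (length_init _ _)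
  intro i h₁ h₂
  have hi : i < (g (i + 1)).length := hlen (i + 1)
  simp only [Text.init, List.getElem_map, List.getElem_range, List.getD_eq_getElem _ _ hi]
  rcases le_total (i + 1) n with h | h
  · exact (hmono _ _ h).getElem hi
  · exact ((hmono _ _ h).getElem h₂).symm

/-! ### Hypothesis spaces -/

theorem etaClosure_eq_self {η : Setoid ℕ} {L : Set ℕ} (h : IsEtaClosed η L) :
    etaClosure η L = L := by
  ext y
  exact ⟨fun ⟨x, hx, hxy⟩ => h x y hxy hx, fun hy => ⟨y, hy, η.refl y⟩⟩

theorem etaClosure_mono (η : Setoid ℕ) {A B : Set ℕ} (h : A ⊆ B) :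
    etaClosure η A ⊆ etaClosure η B :=
  fun _ ⟨x, hx, hxy⟩ => ⟨x, h hx, hxy⟩

/-- A uniformly r.e. numbering reduces to any acceptable one. -/
theorem IsAcceptable.exists_reduction {φ : ℕ → ℕ →. ℕ} (hφ : IsAcceptable φ) {H : ℕ → Set ℕ}
    (hH : UniformlyRE H) : ∃ c : ℕ → ℕ, Computable c ∧ ∀ e, W φ (c e) = H e := by
  obtain ⟨c, hc, h⟩ := hφ.reduces
    (fun e x => (Part.assert (x ∈ H e) fun _ => Part.some ()).map fun _ => 0)
    (Partrec.map (σ := ℕ) hH ((Computable.const 0).to₂))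
  refine ⟨c, hc, fun e => ?_⟩
  ext x
  simp [W, ← h, Part.assert]

/-- Hypotheses are translated along the reduction to `φ`; taking closures changes no member of an
`η`-family. -/
theorem ClassPreservingWeaklyMonotonicExLearnable.exLearnable {φ : ℕ → ℕ →. ℕ}
    (hφ : IsAcceptable φ) {η : Setoid ℕ} {C : Set (Set ℕ)} (hC : IsEtaFamily η C)
    (h : ClassPreservingWeaklyMonotonicExLearnable C) : ExLearnable φ η C := by
  obtain ⟨H, hH, hrange, M, hM, hEx, -⟩ := h
  obtain ⟨c, hc, hcH⟩ := hφ.exists_reduction hH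
  refine ⟨fun σ => (M σ).map c, Computable.option_map hM (hc.comp Computable.snd).to₂,
    fun L hL T hT => ?_⟩
  obtain ⟨n, e, he, hn⟩ := hEx L hL T hT
  refine ⟨n, c e, ?_, fun j hj => by simp [hn j hj]⟩
  rw [defaultSpace, hcH, he, etaClosure_eq_self (hC.2 L hL)]

/-- A finite telltale of `ℕ`: if an explanatorily learnable class contains `ℕ`, then some finite
set is contained in no other member. -/
theorem ExLearns.exists_telltale_univ {H : ℕ → Set ℕ} {M : Learner} {C : Set (Set ℕ)}
    (h : ExLearns H M C) (hU : Set.univ ∈ C) :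
    ∃ D : Set ℕ, D.Finite ∧ ∀ L ∈ C, D ⊆ L → L = Set.univ := by
  by_contra! hcon
  -- Without a telltale, every finite sequence is compatible with some member other than `ℕ`, and
  -- continuing it by a text for that member forces a wrong hypothesis for `ℕ`. Iterating while
  -- inserting every number `x` yields a text for `ℕ` with infinitely many wrong hypotheses.
  have hstep : ∀ (σ : List (Option ℕ)) (x : ℕ), ∃ τ, σ ++ [some x] <+: τ ∧
      ∃ e, M τ = some e ∧ H e ≠ Set.univ := by
    intro σ x
    have hfin : (seqContent (σ ++ [some x])).Finite :=
      ((σ ++ [some x]).finite_toSet.preimage (Option.some_injective ℕ).injOn)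
    obtain ⟨L, hL, hsub, hne⟩ := hcon _ hfin
    obtain ⟨n, e, he, hn⟩ := h L hL _ (content_prepend_textOf hsub)
    refine ⟨_, ?_, e, hn ((σ ++ [some x]).length + n) (Nat.le_add_left _ _), he ▸ hne⟩
    rw [init_prepend]
    exact List.prefix_append _ _
  choose step hpre hbad using hstep
  obtain ⟨g, hgs⟩ : ∃ g : ℕ → List (Option ℕ), ∀ n, g (n + 1) = step (g n) n :=
    ⟨fun n => Nat.rec [] (fun n σ => step σ n) n, fun _ => rfl⟩
  have hg : ∀ n, g n ++ [some n] <+: g (n + 1) := fun n => hgs n ▸ hpre _ _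
  have hlen : ∀ n, n ≤ (g n).length := fun n => by
    induction n with
    | zero => exact Nat.zero_le _
    | succ n ih =>
      have := (hg n).length_le
      rw [List.length_append, List.length_singleton] at this
      omega
  obtain ⟨T, hT⟩ := exists_text_of_chain g (fun n => (List.prefix_append _ _).trans (hg n)) hlen
  have hcontent : T.content = Set.univ := by
    refine Set.eq_univ_of_forall fun x => seqContent_init_subset T (g (x + 1)).length ?_
    rw [hT]
    exact (hg x).subset (by simp)
  obtain ⟨n, e, he, hn⟩ := h _ hU T hcontent
  obtain ⟨e', he', hne⟩ := hbad (g n) n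
  have := hn (g (n + 1)).length ((Nat.le_succ n).trans (hlen _))
  rw [hT, hgs] at this
  have heq : e = e' := Option.some.inj (this.symm.trans he')
  exact hne (heq ▸ he)

/-! ### Monotonic learning when only `ℕ` is r.e. and `η`-infinite. -/

theorem primrecRel_mem_option_list :
    PrimrecRel fun (σ : List (Option ℕ)) (x : ℕ) => some x ∈ σ := by
  have h : PrimrecRel fun (o : Option ℕ) (x : ℕ) => o = some x :=
    PrimrecRel.comp Primrec.eq Primrec.fst (Primrec.option_some.comp Primrec.snd)
  exact h.exists_mem_list.of_eq fun σ x => by simp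

/-- Provides the hypotheses "closure of the data", indexed by codes of sequences. -/
theorem uniformlyRE_seqContent :
    UniformlyRE fun e => seqContent ((Encodable.decode (α := List (Option ℕ)) e).getD []) :=
  PrimrecPred.rePred (primrecRel_mem_option_list.comp
    (Primrec.option_getD.comp (Primrec.decode.comp Primrec.fst) (Primrec.const []))
    Primrec.snd)

theorem uniformlyRE_univ : UniformlyRE fun _ => Set.univ :=
  ((Primrec.eq.comp (Primrec.const 0) (Primrec.const 0)).of_eq fun _ => by simp :
    PrimrecPred fun p : ℕ × ℕ => p.2 ∈ (Set.univ : Set ℕ)).rePred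

/-- If all members of `C` other than `ℕ` consist of finitely many classes and `ℕ` can be recognized
by a primitive recursive event, then `C` is learned by conjecturing the closure of the data. -/
theorem monotonicBCLearnable_of_finite {φ : ℕ → ℕ →. ℕ} (hφ : IsAcceptable φ) {η : Setoid ℕ}
    {C : Set (Set ℕ)} (hclosed : ∀ L ∈ C, IsEtaClosed η L)
    (hfin : ∀ L ∈ C, L = Set.univ ∨ ((Quotient.mk η) '' L).Finite)
    {P : List (Option ℕ) → Prop} (hP : PrimrecPred P)
    (hsound : ∀ σ, P σ → ∀ L ∈ C, seqContent σ ⊆ L → L = Set.univ)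
    (hcomplete : Set.univ ∈ C → ∀ T : Text, T.content = Set.univ → ∃ n, P (T.init n))
    (hmono : ∀ (T : Text) (m n : ℕ), m ≤ n → P (T.init m) → P (T.init n)) :
    MonotonicBCLearnable φ η C := by
  classical
  obtain ⟨c, hc, hcW⟩ := hφ.exists_reduction uniformlyRE_seqContent
  obtain ⟨u, -, huW⟩ := hφ.exists_reduction uniformlyRE_univ
  have hHc : ∀ σ : List (Option ℕ),
      defaultSpace φ η (c (Encodable.encode σ)) = etaClosure η (seqContent σ) := fun σ => by
    rw [defaultSpace, hcW, Encodable.encodek, Option.getD_some]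
  have hHu : defaultSpace φ η (u 0) = Set.univ := by
    rw [defaultSpace, huW]
    exact etaClosure_eq_self fun _ _ _ _ => trivial
  refine ⟨fun σ => if P σ then some (u 0) else some (c (Encodable.encode σ)), ?_, ?_, ?_⟩
  · have hd := hP.decide.to_comp
    exact (Computable.cond hd (Computable.const (some (u 0)))
      (Computable.option_some.comp (hc.comp Computable.encode))).of_eq fun σ => by
        by_cases h : P σ <;> simp [h]
  · intro L hL T hT
    by_cases hU : L = Set.univ
    · subst hU
      obtain ⟨n, hn⟩ := hcomplete hL T hT
      exact ⟨n, fun j hj => ⟨u 0, by simp [hmono T n j hj hn], hHu⟩⟩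
    · have hf := (hfin L hL).resolve_left hU
      -- Once one representative of each of the finitely many classes of `L` has appeared, the
      -- closure of the data is `L`.
      have hsub : (fun q : Quotient η => q.out) '' ((Quotient.mk η) '' L) ⊆ T.content := by
        rintro _ ⟨_, ⟨x, hx, rfl⟩, rfl⟩
        rw [hT]
        exact hclosed L hL x _ (η.symm (Quotient.mk_out x)) hx
      obtain ⟨n, hn⟩ := exists_subset_seqContent_init T (hf.image _) hsub
      refine ⟨n, fun j hj => ⟨c (Encodable.encode (T.init j)), ?_, ?_⟩⟩
      · have : ¬ P (T.init j) := fun h =>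
          hU (hsound _ h L hL (hT ▸ seqContent_init_subset T j))
        simp [this]
      · rw [hHc]
        apply Set.Subset.antisymm
        · rintro y ⟨x, hx, hxy⟩
          exact hclosed L hL x y hxy (hT ▸ seqContent_init_subset T j hx)
        · intro y hy
          exact ⟨_, seqContent_init_mono T hj (hn ⟨_, ⟨y, hy, rfl⟩, rfl⟩), Quotient.mk_out y⟩
  · intro T hT n k i j hi hj
    -- The hypotheses themselves increase, even before intersecting with the content.
    refine Set.inter_subset_inter_left _ ?_
    dsimp only at hi hj
    by_cases hk : P (T.init (n + k))
    · rw [if_pos hk] at hj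
      cases hj
      rw [hHu]
      exact Set.subset_univ _
    · have hn : ¬ P (T.init n) := fun h => hk (hmono T n (n + k) (Nat.le_add_right _ _) h)
      rw [if_neg hk] at hj
      rw [if_neg hn] at hi
      cases hi
      cases hj
      rw [hHc, hHc]
      exact etaClosure_mono η (seqContent_init_mono T (Nat.le_add_right _ _))

/-- By contraposition. Ex-learnability matters only when `ℕ ∈ C`: it supplies the telltale, whose
appearance is the event `P`. Otherwise `P` never has to occur. -/
theorem exists_etaInfinite_of_not_monotonicBCLearnable {φ : ℕ → ℕ →. ℕ} (hφ : IsAcceptable φ)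
    {η : Setoid ℕ} {C : Set (Set ℕ)} (hC : IsEtaFamily η C) (hEx : ExLearnable φ η C)
    (hBC : ¬ MonotonicBCLearnable φ η C) :
    ∃ A : Set ℕ, IsEtaInfinite η A ∧ (REPred fun x : ℕ => x ∈ A) ∧ A ≠ Set.univ := by
  by_contra! hcon
  apply hBC
  obtain ⟨⟨B, hB, -, hrange⟩, hclosed⟩ := hC
  have hfin : ∀ L ∈ C, L = Set.univ ∨ ((Quotient.mk η) '' L).Finite := by
    intro L hL
    by_cases hf : ((Quotient.mk η) '' L).Finite
    · exact Or.inr hf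
    · obtain ⟨k, rfl⟩ : L ∈ Set.range B := hrange ▸ hL
      have hre : REPred fun x : ℕ => x ∈ B k :=
        REPred.comp hB (f := fun x : ℕ => (k, x))
          ((Computable.const k).pair Computable.id)
      exact Or.inl (hcon _ ⟨hclosed _ hL, hf⟩ hre)
  by_cases hU : Set.univ ∈ C
  · obtain ⟨M, -, hM⟩ := hEx
    obtain ⟨D, hD, hDC⟩ := hM.exists_telltale_univ hU
    have hP : PrimrecPred fun σ : List (Option ℕ) => D ⊆ seqContent σ := by
      have h : PrimrecRel fun (l : List ℕ) (σ : List (Option ℕ)) => ∀ x ∈ l, some x ∈ σ :=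
        PrimrecRel.forall_mem_list (R := fun (x : ℕ) (σ : List (Option ℕ)) => some x ∈ σ)
          (primrecRel_mem_option_list.comp Primrec.snd Primrec.fst)
      exact (h.comp (Primrec.const hD.toFinset.toList) Primrec.id).of_eq fun σ => by
        simp [seqContent, Set.subset_def]
    refine monotonicBCLearnable_of_finite hφ hclosed hfin hP ?_ ?_ ?_
    · exact fun σ hσ L hL hsub => hDC L hL (hσ.trans hsub)
    · exact fun _ T hT => exists_subset_seqContent_init T hD (hT ▸ Set.subset_univ D)
    · exact fun T m n hmn h => h.trans (seqContent_init_mono T hmn)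
  · refine monotonicBCLearnable_of_finite hφ hclosed hfin (P := fun _ => False) ?_ ?_ ?_ ?_
    · exact (Primrec.eq.comp (Primrec.const 0) (Primrec.const 1)).of_eq fun _ => by simp
    · exact fun _ h => h.elim
    · exact fun h => absurd h hU
    · exact fun _ _ _ _ h => h

/-- A primitive recursive, monotone approximation of "`x` is equivalent to a number in `σ`". -/
theorem IsPositive.exists_known {η : Setoid ℕ} (hη : IsPositive η) :
    ∃ K : List (Option ℕ) → ℕ → Prop, PrimrecRel K ∧
      (∀ σ x, K σ x → ∃ z ∈ seqContent σ, η z x) ∧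
      (∀ (T : Text) m n x, m ≤ n → K (T.init m) x → K (T.init n) x) ∧
      ∀ (T : Text) x z, z ∈ T.content → η z x → ∃ n, K (T.init n) x := by
  obtain ⟨E, hE, Emono, hEη⟩ := REPred.exists_primrecRel hη
  -- The length of `σ` bounds the steps spent on enumerating `η`, so a longer initial segment has
  -- both more data and more time.
  refine ⟨fun σ x => ∃ o ∈ σ, ∃ z ∈ o.toList, E (z, x) σ.length, ?_, ?_, ?_, ?_⟩
  · have h₁ : PrimrecRel fun (z : ℕ) (y : ℕ × ℕ) => E (z, y.1) y.2 :=
      PrimrecRel.comp hE (Primrec.fst.pair (Primrec.fst.comp Primrec.snd))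
        (Primrec.snd.comp Primrec.snd)
    have h₂ : PrimrecRel fun (o : Option ℕ) (y : ℕ × ℕ) => ∃ z ∈ o.toList, E (z, y.1) y.2 :=
      h₁.exists_mem_list.comp (Primrec.optionToList.comp Primrec.fst) Primrec.snd
    exact h₂.exists_mem_list.comp Primrec.fst
      (Primrec.snd.pair (Primrec.list_length.comp Primrec.fst))
  · rintro σ x ⟨o, ho, z, hz, h⟩
    rw [Option.mem_toList] at hz
    subst hz
    exact ⟨z, ho, (hEη _).2 ⟨_, h⟩⟩
  · rintro T m n x hmn ⟨o, ho, z, hz, h⟩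
    rw [Option.mem_toList] at hz
    subst hz
    refine ⟨some z, seqContent_init_mono T hmn ho, z, by simp, Emono _ _ _ ?_ h⟩
    simpa [length_init] using hmn
  · intro T x z ⟨i, hi⟩ hzx
    obtain ⟨s, hs⟩ := (hEη (z, x)).1 hzx
    refine ⟨max (i + 1) s, some z, ?_, z, by simp, Emono _ s _ ?_ hs⟩
    · have : z ∈ seqContent (T.init (max (i + 1) s)) := by
        rw [seqContent_init]
        exact ⟨i, by omega, hi⟩
      exact this
    · rw [length_init]
      exact le_max_right _ _

/-! ### The marked class of an r.e. `η`-infinite set. -/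

section Diagonal

variable (η : Setoid ℕ) (b : ℕ) (a : ℕ → ℕ)

/-- The union of the classes of `b` and of `a 0, ..., a (j - 1)`. -/
def markedInitial (j : ℕ) : Set ℕ := {x | η b x ∨ ∃ i < j, η (a i) x}

/-- The set of the classes of `a 0, ..., a (j - 1)`. -/
def initialClasses (j : ℕ) : Set (Quotient η) := (fun i => Quotient.mk η (a i)) '' Set.Iio j

/-- The class of the range of `a` and of all the sets `markedInitial η b a j`. -/
def markedClass : Set (Set ℕ) := insert (Set.range a) (Set.range (markedInitial η b a))

/-- A numbering of `markedClass η b a` with repetitions. -/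
def markedSpace : ℕ → Set ℕ
  | 0 => Set.range a
  | j + 1 => markedInitial η b a j

/-- A one-one numbering of `markedClass η b a`: the set numbered `n + 1` comprises `n` classes of
elements of the range of `a`. -/
def markedNumbering : ℕ → Set ℕ
  | 0 => Set.range a
  | n + 1 => {x | η b x ∨
      ∃ j, (initialClasses η a j).ncard ≤ n ∧ ∃ i < j, η (a i) x}

variable {η b a}

theorem finite_initialClasses (j : ℕ) : (initialClasses η a j).Finite :=
  (Set.finite_Iio j).image _

theorem initialClasses_mono {j k : ℕ} (h : j ≤ k) : initialClasses η a j ⊆ initialClasses η a k :=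
  Set.image_mono (Set.Iio_subset_Iio h)

theorem mk_mem_initialClasses {j x : ℕ} :
    Quotient.mk η x ∈ initialClasses η a j ↔ ∃ i < j, η (a i) x :=
  ⟨fun ⟨i, hi, h⟩ => ⟨i, hi, Quotient.exact h⟩, fun ⟨i, hi, h⟩ => ⟨i, hi, Quotient.sound h⟩⟩

theorem markedInitial_mono {j k : ℕ} (h : j ≤ k) : markedInitial η b a j ⊆ markedInitial η b a k :=
  fun _ hx => hx.imp_right fun ⟨i, hi, h'⟩ => ⟨i, hi.trans_le h, h'⟩

theorem isEtaClosed_markedInitial (j : ℕ) : IsEtaClosed η (markedInitial η b a j) := by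
  rintro x y hxy (h | ⟨i, hi, h⟩)
  · exact Or.inl (η.trans h hxy)
  · exact Or.inr ⟨i, hi, η.trans h hxy⟩

theorem isEtaClosed_of_mem_markedClass (hA : IsEtaClosed η (Set.range a)) {L : Set ℕ}
    (hL : L ∈ markedClass η b a) : IsEtaClosed η L := by
  rcases hL with rfl | ⟨j, rfl⟩
  · exact hA
  · exact isEtaClosed_markedInitial j

theorem range_markedSpace : Set.range (markedSpace η b a) = markedClass η b a := by
  ext L
  constructor
  · rintro ⟨_ | j, rfl⟩
    · exact Or.inl rfl
    · exact Or.inr ⟨j, rfl⟩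
  · rintro (rfl | ⟨j, rfl⟩)
    · exact ⟨0, rfl⟩
    · exact ⟨j + 1, rfl⟩

/-- The class of `b` is disjoint from the closed set `Set.range a`, so the mark contributes nothing
there. -/
theorem mem_markedInitial_iff (hA : IsEtaClosed η (Set.range a)) (hb : b ∉ Set.range a)
    {j m : ℕ} : a m ∈ markedInitial η b a j ↔ Quotient.mk η (a m) ∈ initialClasses η a j := by
  rw [mk_mem_initialClasses]
  exact or_iff_right fun h => hb (hA _ _ (η.symm h) ⟨m, rfl⟩)

theorem exists_notMem_initialClasses (hinf : ((Quotient.mk η) '' Set.range a).Infinite) (j : ℕ) :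
    ∃ m, Quotient.mk η (a m) ∉ initialClasses η a j := by
  by_contra! h
  refine hinf ((finite_initialClasses (η := η) (a := a) j).subset ?_)
  rintro _ ⟨_, ⟨m, rfl⟩, rfl⟩
  exact h m

theorem exists_notMem_markedInitial (hA : IsEtaInfinite η (Set.range a)) (hb : b ∉ Set.range a)
    (j : ℕ) : ∃ m, a m ∉ markedInitial η b a j := by
  obtain ⟨m, hm⟩ := exists_notMem_initialClasses hA.2 j
  exact ⟨m, fun h => hm ((mem_markedInitial_iff hA.1 hb).1 h)⟩

/-- Going up to the first `a m` whose class is new raises the number of classes by exactly one. -/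
theorem exists_ncard_initialClasses_eq (hinf : ((Quotient.mk η) '' Set.range a).Infinite) (n : ℕ) :
    ∃ j, (initialClasses η a j).ncard = n := by
  classical
  induction n with
  | zero => exact ⟨0, by simp [initialClasses]⟩
  | succ n ih =>
    obtain ⟨j, hj⟩ := ih
    have hex := exists_notMem_initialClasses hinf j
    refine ⟨Nat.find hex + 1, ?_⟩
    have heq : initialClasses η a (Nat.find hex + 1) =
        insert (Quotient.mk η (a (Nat.find hex))) (initialClasses η a j) := by
      apply Set.Subset.antisymm
      · rintro _ ⟨i, hi, rfl⟩
        rcases Nat.lt_succ_iff_lt_or_eq.1 hi with h | rfl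
        · exact Or.inr (not_not.1 (Nat.find_min hex h))
        · exact Or.inl rfl
      · have hle : j ≤ Nat.find hex := by
          by_contra! hlt
          exact Nat.find_spec hex ⟨_, hlt, rfl⟩
        exact Set.insert_subset ⟨_, Nat.lt_succ_self _, rfl⟩
          (initialClasses_mono (hle.trans (Nat.le_succ _)))
    rw [heq, Set.ncard_insert_of_notMem (Nat.find_spec hex) (finite_initialClasses j), hj]

/-- The sets `initialClasses η a j` form a chain of finite sets, so those with at most `n` elements
all lie in the one with exactly `n`. -/
theorem markedNumbering_succ_eq {j n : ℕ} (h : (initialClasses η a j).ncard = n) :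
    markedNumbering η b a (n + 1) = markedInitial η b a j := by
  apply Set.Subset.antisymm
  · rintro x (hx | ⟨k, hk, hx⟩)
    · exact Or.inl hx
    · right
      rw [← mk_mem_initialClasses] at hx ⊢
      rcases le_total k j with hkj | hjk
      · exact initialClasses_mono hkj hx
      · have := Set.eq_of_subset_of_ncard_le (initialClasses_mono (η := η) (a := a) hjk)
          (h ▸ hk) (finite_initialClasses k)
        rwa [this]
  · rintro x (hx | hx)
    · exact Or.inl hx
    · exact Or.inr ⟨j, h.le, hx⟩

theorem range_markedNumbering (hinf : ((Quotient.mk η) '' Set.range a).Infinite) :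
    Set.range (markedNumbering η b a) = markedClass η b a := by
  ext L
  constructor
  · rintro ⟨_ | n, rfl⟩
    · exact Or.inl rfl
    · obtain ⟨j, hj⟩ := exists_ncard_initialClasses_eq hinf n
      exact Or.inr ⟨j, (markedNumbering_succ_eq hj).symm⟩
  · rintro (rfl | ⟨j, rfl⟩)
    · exact ⟨0, rfl⟩
    · exact ⟨_, markedNumbering_succ_eq rfl⟩

theorem initialClasses_subset_of_markedInitial_subset (hA : IsEtaClosed η (Set.range a))
    (hb : b ∉ Set.range a) {j k : ℕ} (h : markedInitial η b a j ⊆ markedInitial η b a k) :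
    initialClasses η a j ⊆ initialClasses η a k := by
  rintro _ ⟨i, hi, rfl⟩
  exact (mem_markedInitial_iff hA hb).1 (h (Or.inr ⟨i, hi, η.refl _⟩))

theorem injective_markedNumbering (hA : IsEtaInfinite η (Set.range a)) (hb : b ∉ Set.range a) :
    Function.Injective (markedNumbering η b a) := by
  have hb' : ∀ n, b ∈ markedNumbering η b a (n + 1) := fun n => Or.inl (η.refl b)
  rintro (_ | m) (_ | n) h
  · rfl
  · exact (hb (h ▸ hb' n : b ∈ markedNumbering η b a 0)).elim
  · exact (hb (h ▸ hb' m : b ∈ markedNumbering η b a 0)).elim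
  · obtain ⟨j, hj⟩ := exists_ncard_initialClasses_eq hA.2 m
    obtain ⟨k, hk⟩ := exists_ncard_initialClasses_eq hA.2 n
    rw [markedNumbering_succ_eq hj, markedNumbering_succ_eq hk] at h
    rw [← hj, ← hk, Set.Subset.antisymm
      (initialClasses_subset_of_markedInitial_subset hA.1 hb h.subset)
      (initialClasses_subset_of_markedInitial_subset hA.1 hb h.superset)]

/-- An upper bound on the number of classes is certified by a short list and finitely many
equivalences. Only positive information about `η` is involved, which makes the one-one numbering
uniformly r.e. -/
theorem ncard_initialClasses_le_iff {j n : ℕ} : (initialClasses η a j).ncard ≤ n ↔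
    ∃ l : List ℕ, l.length ≤ n ∧ ∀ i < j, ∃ y, y ∈ l ∧ η y (a i) := by
  classical
  constructor
  · intro h
    have hf := finite_initialClasses (η := η) (a := a) j
    refine ⟨hf.toFinset.toList.map Quotient.out, ?_, fun i hi => ?_⟩
    · rw [List.length_map, Finset.length_toList, ← Set.ncard_eq_toFinset_card _ hf]
      exact h
    · exact ⟨(Quotient.mk η (a i)).out,
        List.mem_map.2 ⟨_, by simpa using ⟨i, hi, rfl⟩, rfl⟩, Quotient.mk_out _⟩
  · rintro ⟨l, hl, h⟩
    have hsub : initialClasses η a j ⊆ ((l.map (Quotient.mk η)).toFinset : Set (Quotient η)) := by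
      rintro _ ⟨i, hi, rfl⟩
      obtain ⟨y, hy, hyi⟩ := h i hi
      simp only [List.coe_toFinset, Set.mem_ofPred_eq, List.mem_map]
      exact ⟨y, hy, Quotient.sound hyi⟩
    calc (initialClasses η a j).ncard ≤ _ := Set.ncard_le_ncard hsub (Finset.finite_toSet _)
      _ ≤ l.length := by
        rw [Set.ncard_coe_finset]
        exact (List.toFinset_card_le _).trans (by simp)
      _ ≤ n := hl

theorem rePred_exists_lt_eta (hη : IsPositive η) (ha : Primrec a) :
    REPred fun p : ℕ × ℕ => ∃ i < p.1, η (a i) p.2 := by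
  have hlt : REPred fun y : (ℕ × ℕ) × ℕ => y.2 < y.1.1 :=
    (Primrec.nat_lt.comp Primrec.snd (Primrec.fst.comp Primrec.fst)).rePred
  have heta : REPred fun y : (ℕ × ℕ) × ℕ => η (a y.2) y.1.2 :=
    REPred.comp hη (f := fun y : (ℕ × ℕ) × ℕ => (a y.2, y.1.2))
      ((ha.comp Primrec.snd).pair (Primrec.snd.comp Primrec.fst)).to_comp
  exact (hlt.and heta).exists

theorem rePred_ncard_initialClasses_le (hη : IsPositive η) (ha : Primrec a) :
    REPred fun p : ℕ × ℕ => (initialClasses η a p.1).ncard ≤ p.2 := by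
  have hmem : REPred fun z : (List ℕ × ℕ) × ℕ => ∃ y, y ∈ z.1.1 ∧ η y (a z.2) := by
    have h₁ : REPred fun w : ((List ℕ × ℕ) × ℕ) × ℕ => w.2 ∈ w.1.1.1 := by
      have h : PrimrecRel fun (l : List ℕ) (y : ℕ) => y ∈ l :=
        Primrec.eq.exists_mem_list.of_eq fun l y => by simp
      exact (h.comp (Primrec.fst.comp (Primrec.fst.comp Primrec.fst)) Primrec.snd).rePred
    have h₂ : REPred fun w : ((List ℕ × ℕ) × ℕ) × ℕ => η w.2 (a w.1.2) :=
      REPred.comp hη (f := fun w : ((List ℕ × ℕ) × ℕ) × ℕ => (w.2, a w.1.2))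
        (Primrec.snd.pair (ha.comp (Primrec.snd.comp Primrec.fst))).to_comp
    exact (h₁.and h₂).exists
  have hall : REPred fun q : (ℕ × ℕ) × List ℕ =>
      ∀ i < q.1.1, ∃ y, y ∈ q.2 ∧ η y (a i) :=
    -- The `0` fills a parameter on which `hmem` does not depend.
    REPred.comp (REPred.forall_lt hmem) (f := fun q : (ℕ × ℕ) × List ℕ => ((q.2, 0), q.1.1))
      ((Primrec.snd.pair (Primrec.const 0)).pair (Primrec.fst.comp Primrec.fst)).to_comp
  have hlen : REPred fun q : (ℕ × ℕ) × List ℕ => q.2.length ≤ q.1.2 :=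
    (Primrec.nat_le.comp (Primrec.list_length.comp Primrec.snd)
      (Primrec.snd.comp Primrec.fst)).rePred
  exact (hlen.and hall).exists.of_eq fun p =>
    (ncard_initialClasses_le_iff (j := p.1) (n := p.2)).symm

/-- A sequence of sets is uniformly r.e. if its first member is r.e. and the others are
uniformly r.e. -/
theorem uniformlyRE_of_zero_of_succ {H : ℕ → Set ℕ} (h₀ : REPred fun x : ℕ => x ∈ H 0)
    (h₁ : UniformlyRE fun n => H (n + 1)) : UniformlyRE H := by
  have hz : REPred fun p : ℕ × ℕ => p.1 = 0 :=
    (Primrec.eq.comp Primrec.fst (Primrec.const 0)).rePred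
  have hs : REPred fun p : ℕ × ℕ => 0 < p.1 :=
    (Primrec.nat_lt.comp (Primrec.const 0) Primrec.fst).rePred
  have h₀' : REPred fun p : ℕ × ℕ => p.2 ∈ H 0 := REPred.comp h₀ Computable.snd
  have h₁' : REPred fun p : ℕ × ℕ => p.2 ∈ H (p.1.pred + 1) :=
    REPred.comp h₁ (f := fun p : ℕ × ℕ => (p.1.pred, p.2))
      ((Primrec.pred.comp Primrec.fst).pair Primrec.snd).to_comp
  refine ((hz.and h₀').or (hs.and h₁')).of_eq ?_
  rintro ⟨_ | n, x⟩ <;> simp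

theorem rePred_range (ha : Primrec a) : REPred fun x : ℕ => x ∈ Set.range a := by
  have h : REPred fun p : ℕ × ℕ => a p.2 = p.1 :=
    (Primrec.eq.comp (ha.comp Primrec.snd) Primrec.fst).rePred
  exact h.exists

theorem rePred_eta_right (hη : IsPositive η) : REPred fun p : ℕ × ℕ => η b p.2 :=
  REPred.comp hη (f := fun p : ℕ × ℕ => (b, p.2)) ((Primrec.const b).pair Primrec.snd).to_comp

theorem uniformlyRE_markedSpace (hη : IsPositive η) (ha : Primrec a) :
    UniformlyRE (markedSpace η b a) :=
  uniformlyRE_of_zero_of_succ (rePred_range ha)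
    ((rePred_eta_right hη).or (rePred_exists_lt_eta hη ha))

theorem uniformlyRE_markedNumbering (hη : IsPositive η) (ha : Primrec a) :
    UniformlyRE (markedNumbering η b a) := by
  refine uniformlyRE_of_zero_of_succ (rePred_range ha) ((rePred_eta_right hη).or ?_)
  have h₁ : REPred fun q : (ℕ × ℕ) × ℕ => (initialClasses η a q.2).ncard ≤ q.1.1 :=
    REPred.comp (rePred_ncard_initialClasses_le hη ha) (f := fun q : (ℕ × ℕ) × ℕ => (q.2, q.1.1))
      (Primrec.snd.pair (Primrec.fst.comp Primrec.fst)).to_comp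
  have h₂ : REPred fun q : (ℕ × ℕ) × ℕ => ∃ i < q.2, η (a i) q.1.2 :=
    REPred.comp (rePred_exists_lt_eta hη ha) (f := fun q : (ℕ × ℕ) × ℕ => (q.2, q.1.2))
      (Primrec.snd.pair (Primrec.snd.comp Primrec.fst)).to_comp
  exact (h₁.and h₂).exists

theorem isEtaFamily_markedClass (hη : IsPositive η) (ha : Primrec a)
    (hA : IsEtaInfinite η (Set.range a)) (hb : b ∉ Set.range a) :
    IsEtaFamily η (markedClass η b a) :=
  ⟨⟨markedNumbering η b a, uniformlyRE_markedNumbering hη ha, injective_markedNumbering hA hb,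
    range_markedNumbering hA.2⟩, fun _ => isEtaClosed_of_mem_markedClass hA.1⟩

/-- The learner conjectures `A` until `b` is recognized and from then on the set with index `J σ`.
After `b`, the value of `J` only increases along a text; before `b`, the hypothesis `A` is abandoned
only on data not contained in it. -/
theorem classPreservingWeaklyMonotonicExLearnable_markedClass (hη : IsPositive η) (ha : Primrec a)
    (hA : IsEtaInfinite η (Set.range a)) (hb : b ∉ Set.range a) :
    ClassPreservingWeaklyMonotonicExLearnable (markedClass η b a) := by
  classical
  obtain ⟨K, hK, Ksound, Kmono, Kcomplete⟩ := hη.exists_known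
  have Kmem : ∀ {L : Set ℕ}, IsEtaClosed η L → ∀ {σ x}, seqContent σ ⊆ L → K σ x → x ∈ L :=
    fun hL σ x hσ hx => by
      obtain ⟨z, hz, hzx⟩ := Ksound σ x hx
      exact hL z x hzx (hσ hz)
  -- The least `i` for which `a i` is not yet recognized, or the length of `σ` if there is none
  -- below it.
  let J : List (Option ℕ) → ℕ := fun σ =>
    (List.range σ.length).findIdx fun i => !decide (K σ (a i))
  have J_primrec : Primrec J :=
    Primrec.list_findIdx (Primrec.list_range.comp Primrec.list_length)
      (Primrec.not.comp (hK.decide.comp Primrec.fst (ha.comp Primrec.snd)))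
  have J_of_lt : ∀ σ i, i < J σ → K σ (a i) := fun σ i hi => by
    have := List.not_of_lt_findIdx hi
    simpa using this
  have J_not : ∀ σ, J σ < σ.length → ¬ K σ (a (J σ)) := fun σ h => by
    have := List.findIdx_getElem (xs := List.range σ.length)
      (p := fun i => !decide (K σ (a i))) (w := by simpa using h)
    simpa using this
  have J_le : ∀ σ, J σ ≤ σ.length := fun σ => by
    simpa using List.findIdx_le_length (xs := List.range σ.length)
      (p := fun i => !decide (K σ (a i)))
  let M : Learner := fun σ => if K σ b then some (J σ + 1) else some 0
  have M_pos : ∀ {σ}, K σ b → M σ = some (J σ + 1) := fun h => if_pos h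
  have M_neg : ∀ {σ}, ¬ K σ b → M σ = some 0 := fun h => if_neg h
  refine ⟨markedSpace η b a, uniformlyRE_markedSpace hη ha, range_markedSpace, M, ?_, ?_, ?_⟩
  · exact (Primrec.ite (hK.comp Primrec.id (Primrec.const b))
      (Primrec.option_some.comp (Primrec.succ.comp J_primrec)) (Primrec.const (some 0))).to_comp
  · intro L hL T hT
    have hLclosed := isEtaClosed_of_mem_markedClass hA.1 hL
    have hKL : ∀ {j x}, K (T.init j) x → x ∈ L :=
      fun h => Kmem hLclosed (hT ▸ seqContent_init_subset T _) h
    rcases hL with rfl | ⟨k, rfl⟩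
    · exact ⟨0, 0, rfl, fun j _ => M_neg fun h => hb (hKL h)⟩
    · have hex := exists_notMem_markedInitial hA hb k
      -- The limit of `J` is not `k` but the first index `m` with `a m` outside the set: later terms
      -- of `a` may repeat classes already present. Both indices describe the same set.
      set m := Nat.find hex with hm
      have hin : ∀ i < m, a i ∈ markedInitial η b a k := fun i hi => not_not.1 (Nat.find_min hex hi)
      have hkm : k ≤ m := by
        by_contra! hlt
        exact Nat.find_spec hex (Or.inr ⟨m, hlt, η.refl _⟩)
      have heq : markedInitial η b a m = markedInitial η b a k := by
        refine Set.Subset.antisymm ?_ (markedInitial_mono hkm)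
        rintro x (hx | ⟨i, hi, hx⟩)
        · exact Or.inl hx
        · exact hLclosed _ _ hx (hin i hi)
      have hknown : ∀ x ∈ markedInitial η b a k, ∃ n, K (T.init n) x := fun x hx =>
        Kcomplete T x x (hT ▸ hx) (η.refl x)
      obtain ⟨n₀, hn₀⟩ := hknown b (Or.inl (η.refl b))
      choose! f hf using fun i hi => hknown (a i) (hin i hi)
      refine ⟨max (m + 1) (max n₀ ((Finset.range m).sup f)), m + 1, heq, fun j hj => ?_⟩
      simp only [max_le_iff] at hj
      obtain ⟨hmj, hnj, hfj⟩ := hj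
      rw [M_pos (Kmono T _ _ _ hnj hn₀)]
      have hJ : J (T.init j) = m := by
        apply le_antisymm
        · by_contra! hlt
          exact Nat.find_spec hex (hKL (J_of_lt _ _ hlt))
        · by_contra! hlt
          refine J_not (T.init j) (by rw [length_init]; omega) (Kmono T _ _ _ ?_ (hf _ hlt))
          exact (Finset.le_sup (f := f) (Finset.mem_range.2 hlt)).trans hfj
      rw [hJ]
  · intro T n k i j hi hj hsub
    by_cases hn : K (T.init n) b
    · have hk := Kmono T n (n + k) b (Nat.le_add_right _ _) hn
      rw [M_pos hn] at hi
      rw [M_pos hk] at hj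
      cases hi
      cases hj
      -- If `J` decreased, the unrecognized term at its new value would already have been recognized
      -- earlier.
      refine markedInitial_mono ?_
      by_contra! hlt
      refine J_not (T.init (n + k)) ?_ (Kmono T n _ _ (Nat.le_add_right _ _) (J_of_lt _ _ hlt))
      have := J_le (T.init n)
      rw [length_init] at this ⊢
      omega
    · rw [M_neg hn] at hi
      cases hi
      by_cases hk : K (T.init (n + k)) b
      · exact (hb (Kmem hA.1 hsub hk)).elim
      · rw [M_neg hk] at hj
        cases hj
        exact subset_rfl

/-- One text passes through three targets: `A`, then a marked set containing the data so far, then a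
larger marked set. The second hypothesis loses some `a m` that the first one had and that belongs to
the final target. -/
theorem not_isMonotonic_of_bcLearns_markedClass (hA : IsEtaInfinite η (Set.range a))
    (hb : b ∉ Set.range a) {H : ℕ → Set ℕ} {M : Learner} (hBC : BCLearns H M (markedClass η b a)) :
    ¬ IsMonotonic H M (markedClass η b a) := by
  intro hmon
  let T₀ : Text := fun i => some (a i)
  have hT₀ : T₀.content = Set.range a := by
    ext x
    simp [T₀, Text.content]
  obtain ⟨n, hn⟩ := hBC _ (Or.inl rfl) T₀ hT₀
  obtain ⟨e, he, heA⟩ := hn n le_rfl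
  have hsub₀ : seqContent (T₀.init n) ⊆ markedInitial η b a n := by
    rw [seqContent_init]
    rintro x ⟨i, hi, hx⟩
    cases hx
    exact Or.inr ⟨i, hi, η.refl _⟩
  set T₁ := (textOf (markedInitial η b a n)).prepend (T₀.init n) with hT₁
  have hcont₁ : T₁.content = markedInitial η b a n := content_prepend_textOf hsub₀
  obtain ⟨k, hk⟩ := hBC _ (Or.inr ⟨n, rfl⟩) T₁ hcont₁
  -- Position `n + k` is past the convergence point `k` and still extends the first `n` symbols.
  obtain ⟨e', he', heK⟩ := hk (n + k) (Nat.le_add_left _ _)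
  obtain ⟨m, hm⟩ := exists_notMem_markedInitial hA hb n
  have hnm : n ≤ m + 1 := by
    by_contra! hlt
    exact hm (Or.inr ⟨m, by omega, η.refl _⟩)
  -- Index `m + 1` is the least whose listed terms include `a m` itself.
  set T₂ := (textOf (markedInitial η b a (m + 1))).prepend (T₁.init (n + k)) with hT₂
  have hcont₂ : T₂.content = markedInitial η b a (m + 1) :=
    content_prepend_textOf
      ((hcont₁ ▸ seqContent_init_subset T₁ _ : _ ⊆ markedInitial η b a n).trans
        (markedInitial_mono hnm))
  have h₁ : T₂.init n = T₀.init n := by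
    rw [hT₂, init_prepend_of_le _ _ (Nat.le_add_right n k), hT₁, init_prepend_of_le _ _ le_rfl]
  have h₂ : T₂.init (n + k) = T₁.init (n + k) := init_prepend_of_le _ _ le_rfl
  have := hmon T₂ (hcont₂ ▸ Or.inr ⟨m + 1, rfl⟩) n k e e' (h₁ ▸ he) (h₂ ▸ he')
  rw [heA, heK, hcont₂] at this
  exact hm (this ⟨⟨m, rfl⟩, Or.inr ⟨m, Nat.lt_succ_self m, η.refl _⟩⟩).1

end Diagonal

end EtaLearning

theorem theorem7p7 (φ : ℕ → ℕ →. ℕ) (hφ : EtaLearning.IsAcceptable φ)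
    (η : Setoid ℕ) (hη : EtaLearning.IsPositive η) (hinf : Infinite (Quotient η)) :
    List.TFAE [
      ∃ C : Set (Set ℕ), EtaLearning.IsEtaFamily η C ∧ EtaLearning.ExLearnable φ η C ∧
        ¬ EtaLearning.MonotonicBCLearnable φ η C,
      ∃ C : Set (Set ℕ), EtaLearning.IsEtaFamily η C ∧
        EtaLearning.ClassPreservingWeaklyMonotonicExLearnable C ∧
        ¬ EtaLearning.MonotonicBCLearnable φ η C,
      ∃ A : Set ℕ, EtaLearning.IsEtaInfinite η A ∧ (REPred fun x : ℕ => x ∈ A) ∧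
        A ≠ Set.univ] := by
  tfae_have 1 → 3 := fun ⟨_, hC, hEx, hBC⟩ =>
    EtaLearning.exists_etaInfinite_of_not_monotonicBCLearnable hφ hC hEx hBC
  tfae_have 2 → 1 := fun ⟨C, hC, hEx, hBC⟩ => ⟨C, hC, hEx.exLearnable hφ hC, hBC⟩
  tfae_have 3 → 2 := by
    rintro ⟨A, hA, hre, hne⟩
    obtain ⟨b, hb⟩ := (Set.ne_univ_iff_exists_notMem A).1 hne
    obtain ⟨a, ha, rfl⟩ := hre.exists_primrec_range (Set.image_nonempty.1 hA.2.nonempty)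
    exact ⟨EtaLearning.markedClass η b a, EtaLearning.isEtaFamily_markedClass hη ha hA hb,
      EtaLearning.classPreservingWeaklyMonotonicExLearnable_markedClass hη ha hA hb,
      fun ⟨_, _, hBC, hmon⟩ =>
        EtaLearning.not_isMonotonic_of_bcLearns_markedClass hA hb hBC hmon⟩
  tfae_finish
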